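/- Let $N$ be a natural number and let $\mathbb{G}$ be a compact matrix quantum group in the sense of Woronowicz whose fundamental representation $u=(u_{ij})_{i,j=1}^N\in M_N(C(\mathbb{G}))$ is a magic unitary (each $u_{ij}$ is a projection, and the entries of every row and of every column of $u$ sum to $1$), so that $\mathbb{G}\subseteq S_N^+$, where $C(S_N^+)$ is the universal $\mathrm{C}^*$-algebra generated by the entries of an $N\times N$ magic unitary. Suppose that $\mathbb{G}$ is exotic, $S_N\subsetneq\mathbb{G}\subsetneq S_N^+$, where $S_N$ is given by the magic unitary $(\mathbf 1_{j\to i})_{i,j=1}^N$ over $C(S_N)$, $\mathbf 1_{j\to i}(\sigma)=\delta_{i,\sigma(j)}$. Here, for compact matrix quantum groups $\mathbb{H},\mathbb{G}'$ with $N\times N$ fundamental representations $w,v$, the relation $\mathbb{H}\subsetneq\mathbb{G}'$ means that $v_{ij}\mapsto w_{ij}$ defines a $*$-homomorphism from the $*$-algebra generated by the $v_{ij}$ onto the $*$-algebra generated by the $w_{ij}$, and that this homomorphism is not an isomorphism. Then two entries of $u$ commute only if they lie in a common row or column: for all $i,j,k,l\in\{1,\dots,N\}$, $$u_{ij}u_{kl}=u_{kl}u_{ij}\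 \Longrightarrow\ i=k\ \text{ or }\ j=l .$$ -/

import Mathlib

open scoped ENNReal

universe u

/-! ### The minimal tensor product of C⋆-algebras -/

section MinTensor

open TensorProduct

variable {H K : Type*} [NormedAddCommGroup H] [InnerProductSpace ℂ H]
  [NormedAddCommGroup K] [InnerProductSpace ℂ K]

/-- The Hilbert space tensor product: the completion of the algebraic tensor product with respect
to the inner product `⟪x ⊗ y, x' ⊗ y'⟫ = ⟪x, x'⟫ ⟪y, y'⟫`. -/
def HilbertTensor (H K : Type*) [NormedAddCommGroup H] [InnerProductSpace ℂ H]
    [NormedAddCommGroup K] [InnerProductSpace ℂ K] : Type _ :=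
  UniformSpace.Completion (H ⊗[ℂ] K)

noncomputable instance : NormedAddCommGroup (HilbertTensor H K) :=
  inferInstanceAs (NormedAddCommGroup (UniformSpace.Completion (H ⊗[ℂ] K)))

noncomputable instance : InnerProductSpace ℂ (HilbertTensor H K) :=
  inferInstanceAs (InnerProductSpace ℂ (UniformSpace.Completion (H ⊗[ℂ] K)))

instance : CompleteSpace (HilbertTensor H K) :=
  inferInstanceAs (CompleteSpace (UniformSpace.Completion (H ⊗[ℂ] K)))

/-- The bounded operator `S ⊗ T` on the Hilbert space tensor product. -/
noncomputable def tensorOp (S : H →L[ℂ] H) (T : K →L[ℂ] K) :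
    HilbertTensor H K →L[ℂ] HilbertTensor H K :=
  ((TensorProduct.mapL S T).completion :
    UniformSpace.Completion (H ⊗[ℂ] K) →L[ℂ] UniformSpace.Completion (H ⊗[ℂ] K))

/-- The minimal (spatial) tensor product of `A` and `B`, for faithful representations `π` of `A`
and `ρ` of `B` on Hilbert spaces: the C⋆-algebra generated by the operators `π a ⊗ ρ b`. Up to
isomorphism it does not depend on the faithful representations. -/
noncomputable def minTensor [CompleteSpace H] [CompleteSpace K] {A B : Type*}
    [CStarAlgebra A] [CStarAlgebra B]
    (π : A →⋆ₐ[ℂ] (H →L[ℂ] H)) (ρ : B →⋆ₐ[ℂ] (K →L[ℂ] K)) :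
    StarSubalgebra ℂ (HilbertTensor H K →L[ℂ] HilbertTensor H K) :=
  (StarAlgebra.adjoin ℂ {X | ∃ a b, X = tensorOp (π a) (ρ b)}).topologicalClosure

end MinTensor

/-! ### Compact matrix quantum groups and magic unitaries -/

section QuantumGroups

variable {N : ℕ} {A : Type u} [CStarAlgebra A]

/-- The ⋆-algebra generated (algebraically) by the entries of a matrix. For the fundamental
representation of a compact matrix quantum group `𝔾` this is the dense Hopf ⋆-algebra `𝒪(𝔾)`. -/
def coeffAlgebra (v : Matrix (Fin N) (Fin N) A) : StarSubalgebra ℂ A :=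
  StarAlgebra.adjoin ℂ {x | ∃ i j, x = v i j}

/-- The entry `v i j` as an element of `coeffAlgebra v`. -/
def coeffGen (v : Matrix (Fin N) (Fin N) A) (i j : Fin N) : coeffAlgebra v :=
  ⟨v i j, StarAlgebra.subset_adjoin ℂ _ ⟨i, j, rfl⟩⟩

/-- `(A, v)` is a compact matrix quantum group in the sense of Woronowicz: `A = C(𝔾)` is a unital
C⋆-algebra and `v` is its fundamental representation. -/
structure IsCompactMatrixQuantumGroup (v : Matrix (Fin N) (Fin N) A) : Prop where
  /-- The entries of `v` generate `A` as a C⋆-algebra. -/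
  generates : (coeffAlgebra v).topologicalClosure = ⊤
  unitary : v ∈ unitary (Matrix (Fin N) (Fin N) A)
  invertible : IsUnit v
  invertible_transpose : IsUnit v.transpose
  /-- There is a comultiplication `Δ : A → A ⊗ A` (minimal tensor product, realised through some
  faithful representation `π` of `A`) with `Δ (v i j) = ∑ k, v i k ⊗ v k j`. -/
  comul : ∃ (H : Type u) (_ : NormedAddCommGroup H) (_ : InnerProductSpace ℂ H)
    (_ : CompleteSpace H) (π : A →⋆ₐ[ℂ] (H →L[ℂ] H)), Function.Injective π ∧
      ∃ Δ : A →⋆ₐ[ℂ] minTensor π π, ∀ i j,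
        (Δ (v i j) : HilbertTensor H H →L[ℂ] HilbertTensor H H) =
          ∑ k, tensorOp (π (v i k)) (π (v k j))

/-- A magic unitary: a matrix of projections summing to `1` along every row and every column. -/
structure IsMagicUnitary (v : Matrix (Fin N) (Fin N) A) : Prop where
  proj : ∀ i j, IsStarProjection (v i j)
  row_sum : ∀ i, ∑ k, v i k = 1
  col_sum : ∀ j, ∑ k, v k j = 1

/-- For compact matrix quantum groups `ℍ = (B, w)` and `𝔾 = (A, v)`: `ℍ` is a proper quantum
subgroup of `𝔾`, i.e. `v i j ↦ w i j` defines a ⋆-homomorphism `𝒪(𝔾) → 𝒪(ℍ)` (which is then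
automatically surjective and compatible with the comultiplications) that is not an isomorphism.
Working with the Hopf ⋆-algebras makes the notion independent of the C⋆-completions; if `C(𝔾)` is
the universal completion, it is the same as asking for a ⋆-homomorphism `C(𝔾) → C(ℍ)` with
`v i j ↦ w i j` such that `𝔾 ≠ ℍ`. -/
def IsProperQuantumSubgroup {B A : Type*} [CStarAlgebra B] [CStarAlgebra A]
    (w : Matrix (Fin N) (Fin N) B) (v : Matrix (Fin N) (Fin N) A) : Prop :=
  ∃ π : coeffAlgebra v →⋆ₐ[ℂ] coeffAlgebra w,
    (∀ i j, π (coeffGen v i j) = coeffGen w i j) ∧ ¬ Function.Injective π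

/-- The fundamental representation `(𝟙_{j → i})` of the classical permutation group `S_N`, with
entries in `C(S_N)`, where `𝟙_{j → i}(σ) = δ_{i, σ j}`. -/
def symmFund (N : ℕ) : Matrix (Fin N) (Fin N) (Equiv.Perm (Fin N) → ℂ) :=
  fun i j σ => if i = σ j then 1 else 0

end QuantumGroups

/-! ### The quantum permutation group `S_N⁺` -/

namespace QuantumPermutation

/-- All `N × N` magic unitaries with entries in (nonzero) unital C⋆-algebras. -/
structure Model (N : ℕ) : Type (u + 1) where
  carrier : Type u
  [cstar : CStarAlgebra carrier]
  [nontriv : Nontrivial carrier]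
  mat : Matrix (Fin N) (Fin N) carrier
  magic : IsMagicUnitary mat

attribute [instance] Model.cstar Model.nontriv

noncomputable instance modelCStar (N : ℕ) :
    CStarAlgebra (lp (fun M : Model.{u} N => M.carrier) ∞) where

/-- The family of all `N × N` magic unitaries, as one matrix over the `ℓ^∞`-product. -/
noncomputable def productFund (N : ℕ) :
    Matrix (Fin N) (Fin N) (lp (fun M : Model.{u} N => M.carrier) ∞) :=
  fun i j => ⟨fun M => M.mat i j, memℓp_infty ⟨1, by
    rintro _ ⟨M, rfl⟩
    exact (M.magic.proj i j).norm_le⟩⟩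

/-- `C(S_N⁺)`, the universal C⋆-algebra generated by the entries of an `N × N` magic unitary: the
C⋆-algebra generated by the direct product of all magic unitaries. -/
noncomputable def algebra (N : ℕ) :
    StarSubalgebra ℂ (lp (fun M : Model.{u} N => M.carrier) ∞) :=
  (coeffAlgebra (productFund.{u} N)).topologicalClosure

noncomputable instance algebraCStar (N : ℕ) : CStarAlgebra (algebra.{u} N) :=
  StarSubalgebra.cstarAlgebra _
    (h_closed := StarSubalgebra.isClosed_topologicalClosure (coeffAlgebra (productFund.{u} N)))

/-- The fundamental magic unitary of `S_N⁺`, with entries in `C(S_N⁺)`. -/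
noncomputable def fund (N : ℕ) : Matrix (Fin N) (Fin N) (algebra.{u} N) :=
  fun i j => ⟨productFund N i j,
    StarSubalgebra.le_topologicalClosure _ (coeffGen (productFund N) i j).2⟩

/-- The fundamental matrix of `S_N⁺` is a magic unitary. -/
theorem fund_magic (N : ℕ) : IsMagicUnitary (fund.{u} N) where
  proj i j :=
    ⟨Subtype.ext (Subtype.ext (funext fun M => (M.magic.proj i j).1)),
      Subtype.ext (Subtype.ext (funext fun M => (M.magic.proj i j).2))⟩
  row_sum i := by
    refine Subtype.ext (Subtype.ext (funext fun M => ?_))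
    refine Eq.trans ?_ (M.magic.row_sum i)
    rw [AddSubmonoidClass.coe_finsetSum]
    refine (congrFun (lp.coeFn_sum (fun k => productFund N i k) Finset.univ) M).trans ?_
    simp [productFund]
  col_sum j := by
    refine Subtype.ext (Subtype.ext (funext fun M => ?_))
    refine Eq.trans ?_ (M.magic.col_sum j)
    rw [AddSubmonoidClass.coe_finsetSum]
    refine (congrFun (lp.coeFn_sum (fun k => productFund N k j) Finset.univ) M).trans ?_
    simp [productFund]

/-- The universal property of `C(S_N⁺)`. -/
theorem exists_starAlgHom {N : ℕ} {B : Type u} [CStarAlgebra B] [Nontrivial B]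
    (w : Matrix (Fin N) (Fin N) B) (hw : IsMagicUnitary w) :
    ∃ π : algebra.{u} N →⋆ₐ[ℂ] B, ∀ i j, π (fund N i j) = w i j :=
  ⟨{ toFun := fun x => x.1 (⟨B, w, hw⟩ : Model N)
     map_one' := rfl
     map_mul' := fun _ _ => rfl
     map_zero' := rfl
     map_add' := fun _ _ => rfl
     commutes' := fun _ => rfl
     map_star' := fun _ => rfl }, fun _ _ => rfl⟩

end QuantumPermutation

/-! Suppose `v i j` and `v k l` commute with `i ≠ k` and `j ≠ l`. Since `S_N ⊆ 𝔾`, commutation of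
entries is invariant under permuting rows and columns: apply `Δ` to the relation and evaluate one
tensor leg at a permutation (`commute_perm`). As `S_N` is 2-transitive, all pairs in distinct rows
and columns commute; the other pairs commute by orthogonality. So `𝒪(𝔾)` is commutative, and its map
to `𝒪(S_N)` is then injective (`injective_of_commute`), contradicting `S_N ≠ 𝔾`.

Evaluation at a permutation is a character of `𝒪(𝔾)` that need not extend continuously to `A`, hence
the slicing by arbitrary linear functionals. -/

open TensorProduct in
/-- The elementary tensor `x ⊗ y` in the Hilbert space tensor product. -/
noncomputable def hilbertTmul {H K : Type*} [NormedAddCommGroup H] [InnerProductSpace ℂ H]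
    [NormedAddCommGroup K] [InnerProductSpace ℂ K] (x : H) (y : K) : HilbertTensor H K :=
  ((x ⊗ₜ[ℂ] y : H ⊗[ℂ] K) : UniformSpace.Completion (H ⊗[ℂ] K))

/-! ### Slicing finite sums of operator tensors -/

section Slicing

variable {H K : Type*} [NormedAddCommGroup H] [InnerProductSpace ℂ H]
  [NormedAddCommGroup K] [InnerProductSpace ℂ K]

theorem tensorOp_hilbertTmul (S : H →L[ℂ] H) (T : K →L[ℂ] K) (x : H) (y : K) :
    tensorOp S T (hilbertTmul x y) = hilbertTmul (S x) (T y) :=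
  ContinuousLinearMap.completion_apply_coe (TensorProduct.mapL S T) (x ⊗ₜ[ℂ] y)

theorem inner_hilbertTmul (x x' : H) (y y' : K) :
    inner ℂ (hilbertTmul x y) (hilbertTmul x' y') = inner ℂ x x' * inner ℂ y y' :=
  (UniformSpace.Completion.inner_coe (𝕜 := ℂ) (x ⊗ₜ[ℂ] y) (x' ⊗ₜ[ℂ] y')).trans
    (TensorProduct.inner_tmul (𝕜 := ℂ) x x' y y')

/-- Families of operators that agree on elementary tensors have equal matrix coefficients. -/
theorem sum_inner_mul_inner_eq {ι : Type*} [Fintype ι] {S S' : ι → H →L[ℂ] H}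
    {T T' : ι → K →L[ℂ] K}
    (h : ∀ x y, ∑ r, hilbertTmul (S r x) (T r y) = ∑ r, hilbertTmul (S' r x) (T' r y))
    (x x' : H) (y y' : K) :
    ∑ r, inner ℂ x (S r x') * inner ℂ y (T r y') =
      ∑ r, inner ℂ x (S' r x') * inner ℂ y (T' r y') := by
  have := congrArg (fun z => inner ℂ (hilbertTmul x y) z) (h x' y')
  simpa only [inner_sum, inner_hilbertTmul] using this

/-- Slice maps on the first tensor leg are well defined for arbitrary linear functionals. -/
theorem slice_left {ι : Type*} [Fintype ι] {S S' : ι → H →L[ℂ] H} {T T' : ι → K →L[ℂ] K}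
    (h : ∀ x y, ∑ r, hilbertTmul (S r x) (T r y) = ∑ r, hilbertTmul (S' r x) (T' r y))
    (f : (H →L[ℂ] H) →ₗ[ℂ] ℂ) : ∑ r, f (S r) • T r = ∑ r, f (S' r) • T' r := by
  ext y'
  refine ext_inner_left ℂ fun y => ?_
  -- Freezing a matrix coefficient of the second leg leaves a finite identity between operators on
  -- `H`, to which `f` applies without any continuity.
  have key : ∑ r, inner ℂ y (T r y') • S r = ∑ r, inner ℂ y (T' r y') • S' r := by
    ext x'
    refine ext_inner_left ℂ fun x => ?_
    simpa [_root_.sum_apply, inner_sum, inner_smul_right, mul_comm] using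
      sum_inner_mul_inner_eq h x x' y y'
  simpa [_root_.sum_apply, inner_sum, inner_smul_right, mul_comm] using congrArg f key

/-- Slice maps on the second tensor leg are well defined for arbitrary linear functionals. -/
theorem slice_right {ι : Type*} [Fintype ι] {S S' : ι → H →L[ℂ] H} {T T' : ι → K →L[ℂ] K}
    (h : ∀ x y, ∑ r, hilbertTmul (S r x) (T r y) = ∑ r, hilbertTmul (S' r x) (T' r y))
    (f : (K →L[ℂ] K) →ₗ[ℂ] ℂ) : ∑ r, f (T r) • S r = ∑ r, f (T' r) • S' r := by
  ext x'
  refine ext_inner_left ℂ fun x => ?_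
  have key : ∑ r, inner ℂ x (S r x') • T r = ∑ r, inner ℂ x (S' r x') • T' r := by
    ext y'
    refine ext_inner_left ℂ fun y => ?_
    simpa [_root_.sum_apply, inner_sum, inner_smul_right] using
      sum_inner_mul_inner_eq h x x' y y'
  simpa [_root_.sum_apply, inner_sum, inner_smul_right, mul_comm] using congrArg f key

end Slicing

/-! ### Orthogonality and permanents -/

/-- Projections in a C⋆-algebra that sum to `1` are pairwise orthogonal. -/
theorem IsStarProjection.mul_eq_zero_of_sum_eq_one {A ι : Type*} [CStarAlgebra A] [Fintype ι]
    {p : ι → A} (hp : ∀ k, IsStarProjection (p k)) (hsum : ∑ k, p k = 1) {k l : ι} (hkl : k ≠ l) :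
    p k * p l = 0 := by
  classical
  let _ := CStarAlgebra.spectralOrder A
  let _ := CStarAlgebra.spectralOrderedRing A
  have hsq (m : ι) : p l * p m * p l = star (p m * p l) * (p m * p l) := by
    rw [star_mul, (hp m).2.star_eq, (hp l).2.star_eq, mul_assoc, mul_assoc, ← mul_assoc (p m) (p m),
      (hp m).1.eq]
  -- Compressing `∑ m, p m = 1` by `p l` gives `p l`, already the term `m = l`. The remaining terms
  -- are positive, so each vanishes.
  have hzero : ∑ m ∈ Finset.univ.erase l, p l * p m * p l = 0 := by
    have h : ∑ m, p l * p m * p l = p l := by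
      rw [← Finset.sum_mul, ← Finset.mul_sum, hsum, mul_one, (hp l).1.eq]
    rw [← Finset.add_sum_erase _ _ (Finset.mem_univ l), (hp l).1.eq, (hp l).1.eq] at h
    simpa using h
  rw [Finset.sum_eq_zero_iff_of_nonneg fun m _ => hsq m ▸ star_mul_self_nonneg _] at hzero
  exact (CStarRing.star_mul_self_eq_zero_iff _).1
    (hsq k ▸ hzero k (Finset.mem_erase.2 ⟨hkl, Finset.mem_univ k⟩))

/-- If the columns of a matrix sum to `1` and distinct entries in a row are orthogonal, then its
permanent is `1`. -/
theorem Matrix.permanent_eq_one_of_col_sum_of_row_orthogonal {n R : Type*} [Fintype n]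
    [DecidableEq n] [CommRing R] {v : Matrix n n R} (hsum : ∀ j, ∑ k, v k j = 1)
    (horth : ∀ i j l, j ≠ l → v i j * v i l = 0) : v.permanent = 1 := by
  -- Expand the product of the column sums over all maps `f`; a non-injective `f` picks two entries
  -- of one row, so only permutations contribute.
  have h : ∑ f : n → n, ∏ j, v (f j) j = 1 := by
    have := Finset.prod_univ_sum (fun _ : n => Finset.univ) fun j k => v k j
    rw [Fintype.piFinset_univ] at this
    simp [← this, hsum]
  rw [← h, Matrix.permanent]
  refine Finset.sum_of_injOn (fun σ : Equiv.Perm n => (σ : n → n))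
    DFunLike.coe_injective.injOn (by simp) (fun f _ hf => ?_) (fun _ _ => rfl)
  have hinj : ¬ Function.Injective f := fun hinj => hf
    ⟨Equiv.ofBijective f (Finite.injective_iff_bijective.1 hinj), by simp, rfl⟩
  obtain ⟨a, b, hab, hne⟩ : ∃ a b, f a = f b ∧ a ≠ b := by
    simpa [Function.Injective] using hinj
  rw [← Finset.mul_prod_erase _ _ (Finset.mem_univ a),
    ← Finset.mul_prod_erase _ _ (Finset.mem_erase.2 ⟨hne.symm, Finset.mem_univ b⟩), ← mul_assoc,
    hab, horth _ _ _ hne, zero_mul]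

/-! ### Commutation in magic unitaries and quantum groups -/

section QuantumGroups

variable {N : ℕ} {A : Type u} [CStarAlgebra A] {v : Matrix (Fin N) (Fin N) A}

theorem IsMagicUnitary.row_orthogonal (hv : IsMagicUnitary v) (i : Fin N) {j l : Fin N}
    (h : j ≠ l) : v i j * v i l = 0 :=
  IsStarProjection.mul_eq_zero_of_sum_eq_one (fun k => hv.proj i k) (hv.row_sum i) h

theorem IsMagicUnitary.col_orthogonal (hv : IsMagicUnitary v) (j : Fin N) {i k : Fin N}
    (h : i ≠ k) : v i j * v k j = 0 :=
  IsStarProjection.mul_eq_zero_of_sum_eq_one (fun m => hv.proj m j) (hv.col_sum j) h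

open scoped IsMulCommutative in
/-- A magic unitary with commuting entries gives a resolution of the identity, indexed by
permutations, that diagonalizes its entries. -/
theorem IsMagicUnitary.exists_resolution_of_commute (hv : IsMagicUnitary v)
    (hcomm : ∀ i j k l, Commute (v i j) (v k l)) :
    ∃ e : Equiv.Perm (Fin N) → A, ∑ σ, e σ = 1 ∧
      ∀ i j σ, v i j * e σ = (if i = σ j then (1 : ℂ) else 0) • e σ := by
  have : IsMulCommutative (coeffAlgebra v) := StarAlgebra.isMulCommutative_adjoin ℂ
    (by rintro _ ⟨i, j, rfl⟩ _ ⟨k, l, rfl⟩; exact hcomm i j k l)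
    (by
      rintro _ ⟨i, j, rfl⟩ _ ⟨k, l, rfl⟩
      rw [(hv.proj k l).2.star_eq]
      exact hcomm i j k l)
  let ι : coeffAlgebra v →+* A := (coeffAlgebra v).subtype.toAlgHom.toRingHom
  have hι : Function.Injective ι := Subtype.val_injective
  have hgen (i j) : ι (coeffGen v i j) = v i j := rfl
  -- The sum of these products is the permanent of `v`, taken in the commutative ring `coeffAlgebra
  -- v`.
  refine ⟨fun σ => ι (∏ j, coeffGen v (σ j) j), ?_, fun i j σ => ?_⟩
  · rw [← map_sum, ← map_one ι]
    refine congrArg ι (Matrix.permanent_eq_one_of_col_sum_of_row_orthogonal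
      (v := Matrix.of fun i j => coeffGen v i j) (fun j => hι ?_) fun i j l h => hι ?_)
    · simpa only [Matrix.of_apply, map_sum, map_one, hgen] using hv.col_sum j
    · simpa only [Matrix.of_apply, map_mul, map_zero, hgen] using hv.row_orthogonal i h
  · beta_reduce
    rw [← Finset.mul_prod_erase _ _ (Finset.mem_univ j), map_mul, hgen, ← mul_assoc]
    split_ifs with h
    · rw [← h, (hv.proj i j).1.eq, one_smul]
    · rw [hv.col_orthogonal j h, zero_mul, zero_smul]

/-- A vector that is a joint eigenvector of the entries of `v`, with eigenvalues given by a
character of the coefficient algebra, is a joint eigenvector of the coefficient algebra. -/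
theorem IsMagicUnitary.coe_mul_eq_smul (hv : IsMagicUnitary v) (χ : coeffAlgebra v →ₐ[ℂ] ℂ) (e : A)
    (he : ∀ i j, v i j * e = χ (coeffGen v i j) • e) (x : coeffAlgebra v) :
    (x : A) * e = χ x • e := by
  -- The generators are self-adjoint, so no star case is needed in the induction.
  have hstar : star {x | ∃ i j, x = v i j} = {x | ∃ i j, x = v i j} := by
    ext x
    refine exists₂_congr fun i j => ?_
    rw [star_eq_iff_star_eq, (hv.proj i j).2.star_eq, eq_comm]
  have hmem {x : A} : x ∈ Algebra.adjoin ℂ {x | ∃ i j, x = v i j} ↔ x ∈ coeffAlgebra v := by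
    rw [coeffAlgebra, ← StarSubalgebra.mem_toSubalgebra, StarAlgebra.adjoin_toSubalgebra, hstar,
      Set.union_self]
  have hmul (x : A) (hx : x ∈ Algebra.adjoin ℂ {x | ∃ i j, x = v i j}) :
      x * e = χ ⟨x, hmem.1 hx⟩ • e := by
    induction hx using Algebra.adjoin_induction with
    | mem x hx =>
      obtain ⟨i, j, rfl⟩ := hx
      exact he i j
    | algebraMap r =>
      have h : (⟨algebraMap ℂ A r, hmem.1 (Subalgebra.algebraMap_mem _ r)⟩ : coeffAlgebra v) =
        algebraMap ℂ (coeffAlgebra v) r := Subtype.ext rfl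
      rw [h, AlgHom.commutes, Algebra.algebraMap_self_apply, Algebra.smul_def]
    | add x y hx hy hx' hy' =>
      have h : (⟨x + y, hmem.1 (add_mem hx hy)⟩ : coeffAlgebra v) = ⟨x, hmem.1 hx⟩ + ⟨y, hmem.1 hy⟩ :=
        Subtype.ext rfl
      rw [h, add_mul, hx', hy', ← add_smul, map_add]
    | mul x y hx hy hx' hy' =>
      have h : (⟨x * y, hmem.1 (mul_mem hx hy)⟩ : coeffAlgebra v) = ⟨x, hmem.1 hx⟩ * ⟨y, hmem.1 hy⟩ :=
        Subtype.ext rfl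
      rw [h, mul_assoc, hy', mul_smul_comm, hx', smul_smul, mul_comm, map_mul]
  exact hmul x.1 (hmem.2 x.2)

/-- A ⋆-homomorphism from the coefficient algebra of a magic unitary with commuting entries onto
that of `S_N` is injective. -/
theorem IsMagicUnitary.injective_of_commute (hv : IsMagicUnitary v)
    (hcomm : ∀ i j k l, Commute (v i j) (v k l))
    (φ : coeffAlgebra v →⋆ₐ[ℂ] coeffAlgebra (symmFund N))
    (hφ : ∀ i j, φ (coeffGen v i j) = coeffGen (symmFund N) i j) : Function.Injective φ := by
  obtain ⟨e, hsum, he⟩ := hv.exists_resolution_of_commute hcomm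
  let χ (σ : Equiv.Perm (Fin N)) : coeffAlgebra v →ₐ[ℂ] ℂ :=
    ((Pi.evalAlgHom ℂ (fun _ => ℂ) σ).comp (coeffAlgebra (symmFund N)).subtype.toAlgHom).comp
      φ.toAlgHom
  have hχ (σ) (x : coeffAlgebra v) : χ σ x = (φ x).1 σ := rfl
  refine (injective_iff_map_eq_zero φ).2 fun x hx => Subtype.ext ?_
  change x.1 = 0
  -- `x = ∑ σ, x * e σ = ∑ σ, χ σ x • e σ`, and `χ σ x` is the value of `φ x` at `σ`.
  rw [← mul_one x.1, ← hsum, Finset.mul_sum]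
  refine Finset.sum_eq_zero fun σ _ => ?_
  rw [hv.coe_mul_eq_smul (χ σ) (e σ) (fun i j => ?_) x, hχ, hx]
  · exact zero_smul ℂ _
  · rw [he, hχ, hφ]
    rfl

/-- If `S_N ⊆ 𝔾`, the relation of commutation between entries of the fundamental representation
is invariant under permuting the rows and the columns. -/
theorem IsCompactMatrixQuantumGroup.commute_perm (hG : IsCompactMatrixQuantumGroup v)
    (φ : coeffAlgebra v →⋆ₐ[ℂ] coeffAlgebra (symmFund N))
    (hφ : ∀ i j, φ (coeffGen v i j) = coeffGen (symmFund N) i j) {i j k l : Fin N}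
    (h : Commute (v i j) (v k l)) (σ τ : Equiv.Perm (Fin N)) :
    Commute (v (σ i) (τ j)) (v (σ k) (τ l)) := by
  obtain ⟨H, _, _, _, π, hπ, Δ, hΔ⟩ := hG.comul
  -- A purely algebraic left inverse `g` of `π` on `𝒪(𝔾)` extends evaluation at `ρ` to a linear
  -- functional `ev ρ` on all bounded operators.
  obtain ⟨g, hg⟩ := LinearMap.exists_leftInverse_of_injective
    ((π : A →ₗ[ℂ] H →L[ℂ] H) ∘ₗ (coeffAlgebra v).toSubalgebra.toSubmodule.subtype)
    (LinearMap.ker_eq_bot.2 (hπ.comp Subtype.val_injective))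
  let ev (ρ : Equiv.Perm (Fin N)) : (H →L[ℂ] H) →ₗ[ℂ] ℂ :=
    (LinearMap.proj ρ) ∘ₗ (coeffAlgebra (symmFund N)).toSubalgebra.toSubmodule.subtype ∘ₗ
      (φ : coeffAlgebra v →ₗ[ℂ] coeffAlgebra (symmFund N)) ∘ₗ g
  have hev (ρ a b c d) : ev ρ (π (v a b) * π (v c d)) =
      (if a = ρ b then 1 else 0) * (if c = ρ d then 1 else 0) := by
    have : g (π (v a b) * π (v c d)) = coeffGen v a b * coeffGen v c d := by
      rw [← map_mul]
      exact LinearMap.congr_fun hg (coeffGen v a b * coeffGen v c d)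
    change (φ (g (π (v a b) * π (v c d)))).1 ρ = _
    rw [this, map_mul, hφ, hφ]
    rfl
  have hΔmul (a b c d) (x y : H) :
      (Δ (v a b * v c d) : HilbertTensor H H →L[ℂ] HilbertTensor H H) (hilbertTmul x y) =
        ∑ r : Fin N × Fin N, hilbertTmul ((π (v a r.1) * π (v c r.2)) x)
          ((π (v r.1 b) * π (v r.2 d)) y) := by
    rw [map_mul]
    change (Δ (v a b)).1 ((Δ (v c d)).1 _) = _
    rw [hΔ, hΔ]
    simp only [_root_.sum_apply, map_sum, tensorOp_hilbertTmul]
    rw [Finset.sum_comm, Fintype.sum_prod_type]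
    rfl
  have hrow {i j k l : Fin N} (h : Commute (v i j) (v k l)) (σ : Equiv.Perm (Fin N)) :
      Commute (v (σ i) j) (v (σ k) l) := by
    -- The first leg evaluates to `δ` of `i = σ⁻¹ r.1` and `k = σ⁻¹ r.2`; the inverse makes the
    -- surviving rows `σ i` and `σ k`.
    have key := slice_left (T := fun r : Fin N × Fin N => π (v r.1 j) * π (v r.2 l))
      (T' := fun r : Fin N × Fin N => π (v r.1 l) * π (v r.2 j))
      (fun x y => by rw [← hΔmul, ← hΔmul, h.eq]) (ev σ⁻¹)
    simp only [hev, Equiv.Perm.eq_inv_iff_eq, Fintype.sum_prod_type] at key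
    refine hπ ?_
    simpa using key
  have hcol {i j k l : Fin N} (h : Commute (v i j) (v k l)) (σ : Equiv.Perm (Fin N)) :
      Commute (v i (σ j)) (v k (σ l)) := by
    have key := slice_right (S := fun r : Fin N × Fin N => π (v i r.1) * π (v k r.2))
      (S' := fun r : Fin N × Fin N => π (v k r.1) * π (v i r.2))
      (fun x y => by rw [← hΔmul, ← hΔmul, h.eq]) (ev σ)
    simp only [hev, Fintype.sum_prod_type] at key
    refine hπ ?_
    simpa using key
  exact hcol (hrow h σ) τ

end QuantumGroups

theorem mainTheorem5 {N : ℕ} {A : Type u} [CStarAlgebra A] (v : Matrix (Fin N) (Fin N) A)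
    (hG : IsCompactMatrixQuantumGroup v) (hmagic : IsMagicUnitary v)
    (hclassical : IsProperQuantumSubgroup (symmFund N) v)
    (hquantum : IsProperQuantumSubgroup v (QuantumPermutation.fund.{u} N))
    (i j k l : Fin N) (hcomm : Commute (v i j) (v k l)) :
    i = k ∨ j = l := by
  by_contra! hne
  obtain ⟨φ, hφ, hinj⟩ := hclassical
  refine hinj (hmagic.injective_of_commute (fun a b c d => ?_) φ hφ)
  have hperm {x y x' y' : Fin N} (h : x ≠ y) (h' : x' ≠ y') :
      ∃ σ : Equiv.Perm (Fin N), σ x = x' ∧ σ y = y' := by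
    -- The first swap sends `x` to `x'`; the second corrects the image of `y` and fixes `x'`, which
    -- is neither that image nor `y'`.
    refine ⟨(Equiv.swap x x').trans (Equiv.swap (Equiv.swap x x' y) y'), ?_, by simp⟩
    have : Equiv.swap x x' y ≠ x' := fun e =>
      h ((Equiv.swap x x').injective (by rw [e, Equiv.swap_apply_left]))
    simp [Equiv.swap_apply_of_ne_of_ne this.symm h']
  by_cases hac : a = c
  · subst hac
    by_cases hbd : b = d
    · subst hbd
      exact Commute.refl _
    · exact (hmagic.row_orthogonal a hbd).trans (hmagic.row_orthogonal a (Ne.symm hbd)).symm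
  · by_cases hbd : b = d
    · subst hbd
      exact (hmagic.col_orthogonal b hac).trans (hmagic.col_orthogonal b (Ne.symm hac)).symm
    · obtain ⟨σ, rfl, rfl⟩ := hperm hne.1 hac
      obtain ⟨τ, rfl, rfl⟩ := hperm hne.2 hbd
      exact hG.commute_perm φ hφ hcomm σ τ
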